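/- **Setting.** Let $T=(S_T,O_T,s_0,E,\Pi,L_T,w_T)$ be a weighted transition system of a robot: $S_T$ is a set of cells, $O_T\subset S_T$ are the obstacles, $s_0\in S_T\setminus O_T$ is the initial cell, $E\subseteq (S_T\setminus O_T)^2$ are the moves, $L_T:S_T\to 2^{\Pi}$ is the labelling and $w_T:E\to\mathbb R_{>0}$ gives the durations of the moves. Let $\varphi$ be an LTL formula over $\Pi$ and let $B=(S_B,S_{B_0},\delta,F)$ be a Büchi automaton with finitely many states whose transitions carry conjunctions of literals over $\Pi$ and which accepts exactly the infinite words that satisfy $\varphi$. The *product graph* $P$ has the nodes $S_T\times S_B$, the initial nodes $\{s_0\}\times S_{B_0}$, and an edge $(s,q)\to(s',q')$ iff $(s,s')\in E$ and $B$ has a transition $q\xrightarrow{c}q'$ with $L_T(s')\models c$. Two nodes $v=(s,q)$, $v'=(s',q')$ obey the *distinct node condition* if $v\ne v'$, $q$ has a self loop whose condition $c_{neg}$ has no positive literal, and there is a transition $q\xrightarrow{c_{pos}}q'$ whose condition has a positive literal and satisfies $L_T(s')\models c_{pos}$. A *reduced graph* $G_r$ is a graph on a set of nodes in $S_T\times S_B$,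 with a root, in which each edge joins two nodes that are adjacent in $P$ or obey the distinct node condition. The robot traverses an edge $v\to v'$ by one move, if the nodes are adjacent in $P$, or, if they obey the distinct node condition, along any path of moves from $s$ to $s'$ whose inner cells all satisfy one such condition $c_{neg}$ (meanwhile $B$ stays in $q$). Given durations of the moves that may depend on the starting time, may be infinite and are never less than $w_T$ (dynamic obstacles), the cost of an edge at a given time is the least duration of such a traversal, and lengths of walks in $G_r$ are measured with these costs. A *destination* is a node $(s,q)$ of $G_r$ with $q\in F$ from which a suffix cycle (a closed walk) exists in the static workspace. **The algorithm DT\*.** It starts at an initial node of $P$, the root of a reduced graph, with a static plan $R_{pref}\cdot R_{suff}^{\omega}$: a shortest path to a destination, followed by a suffix cycle of least length among those of all reachable destinations. The robot follows its current plan node by node. Whenever a change of the environment is observed, or the plan is finished, $G_r$ is replaced by a reduced graph whose root is the current node, and new plans are computed at intervals of length $\nu$ until one is found. A plan computed at time $t$ with horizon $H$ is a sequence of timed decisions $\langle (l_1,t_1),\dots,(l_k,t_k)\rangle$ from the timed node $(l_0,t_0)=(\text{root},t)$. Each decision from $(l_i,t_i)$ to $(l_{i+1},t_{i+1})$ is a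 quickest walk in $G_r$ from $l_i$ at time $t_i$ to a destination $l_{i+1}$, completed at time $t_{i+1}\le t+H$: a suffix cycle if $l_{i+1}=l_i$ and a prefix path otherwise. The sequence is read off a solution $X$ (the set of the true variables $X_{l,t}$) of the following constraints on the tree of all possible decisions: $X_{l_0,t_0}$ is true; a true variable other than $X_{l_0,t_0}$ is reached by a possible decision from a true one; from a true variable at which a decision is possible some possible decision leads to a true one; at most one of the outcomes of the decisions possible at a node of the tree is true; at most one variable is true at each time; and if the decision from $(l,t)$ to $(l',t')$ is possible and both variables are true, then none is true at a time strictly between $t$ and $t'$. The solution completes at least one cycle and is optimal for the lexicographic objective: most cycles completed, then shortest last cycle, then earliest completion of the last cycle. An infinite sequence $\sigma=(s_0,q_0)(s_1,q_1)\dots$ of nodes *obeys* $\varphi$ if its first cell is the initial cell of $T$, $(s_n,s_{n+1})\in E$ for all $n$, and the word $L_T(s_1)L_T(s_2)L_T(s_3)\dots$ of the cells that are entered (the word that $B$ reads in the product graph) satisfies $\varphi$; if moreover $B$ can move from some initial state to $q_0$ by reading $L_T(s_0)$, then $L_T(s_0)L_T(s_1)L_T(s_2)\dots$ is also required to satisfy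 $\varphi$. **Theorem (Soundness).** Every plan generated by DT\* obeys $\varphi$, in the following sense. 1. In every configuration that DT\* can reach, some infinite sequence of nodes that obeys $\varphi$ extends the trajectory of the robot up to now followed by the remaining part of its current plan (by the trajectory alone while a new plan is being computed). For a static plan the infinite sequence is the trajectory followed by the remaining part of $R_{pref}\cdot R_{suff}^{\omega}$ itself. 2. In every timed sequence of decisions that DT\* generates, each decision, from $(l_i,t_i)$ to $(l_{i+1},t_{i+1})$, is carried out by a path from $l_i$ to $l_{i+1}$ in the product graph $P$. If $l_i=l_{i+1}$, then the trajectory up to the time of planning, followed by the paths of the earlier decisions of the plan and by this suffix cycle repeated forever, obeys $\varphi$. -/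

import Mathlib

namespace DTStar

/-! ### Linear temporal logic -/

/-- LTL formulas over the atomic propositions `AP`. -/
inductive LTL (AP : Type*) where
  | tt : LTL AP
  | atom : AP → LTL AP
  | neg : LTL AP → LTL AP
  | and : LTL AP → LTL AP → LTL AP
  | next : LTL AP → LTL AP
  | until : LTL AP → LTL AP → LTL AP

/-- `φ.Sat w`: the infinite word `w` over `2^AP` satisfies `φ`. -/
def LTL.Sat {AP : Type*} : LTL AP → (ℕ → Set AP) → Prop
  | .tt, _ => True
  | .atom a, w => a ∈ w 0
  | .neg φ, w => ¬ φ.Sat w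
  | .and φ ψ, w => φ.Sat w ∧ ψ.Sat w
  | .next φ, w => φ.Sat (fun n => w (n + 1))
  | .until φ ψ, w =>
      ∃ k, ψ.Sat (fun n => w (n + k)) ∧ ∀ t < k, φ.Sat (fun n => w (n + t))

/-! ### Büchi automata -/

/-- A transition condition: a conjunction of literals, such as `p₁ ∧ ¬p₂`. -/
structure Cond (AP : Type*) where
  /-- the propositions that occur positively -/
  pos : Finset AP
  /-- the propositions that occur negated -/
  neg : Finset AP

/-- The letter `a ∈ 2^AP` satisfies the transition condition. -/
def Cond.Sat {AP : Type*} (c : Cond AP) (a : Set AP) : Prop :=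
  (∀ p ∈ c.pos, p ∈ a) ∧ ∀ p ∈ c.neg, p ∉ a

/-- `c` is of the kind `c_neg`: it has no positive literal. -/
def Cond.Negative {AP : Type*} (c : Cond AP) : Prop := c.pos = ∅

/-- `c` is of the kind `c_pos`: it has a positive literal. -/
def Cond.Positive {AP : Type*} (c : Cond AP) : Prop := c.pos.Nonempty

/-- A (nondeterministic) Büchi automaton whose transitions carry conjunctions of literals. -/
structure BuchiAutomaton (AP Q : Type*) where
  init : Set Q
  trans : Q → Cond AP → Q → Prop
  final : Set Q

/-- In state `q`, reading the letter `a`, the automaton may move to `q'`. -/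
def BuchiAutomaton.Step {AP Q : Type*} (B : BuchiAutomaton AP Q) (q : Q) (a : Set AP) (q' : Q) :
    Prop :=
  ∃ c, B.trans q c q' ∧ c.Sat a

/-- `w` is accepted: some run over `w` visits some final state infinitely often. -/
def BuchiAutomaton.Accepts {AP Q : Type*} (B : BuchiAutomaton AP Q) (w : ℕ → Set AP) : Prop :=
  ∃ ρ : ℕ → Q, ρ 0 ∈ B.init ∧ (∀ n, B.Step (ρ n) (w n) (ρ (n + 1))) ∧
    ∃ f ∈ B.final, ∃ᶠ n in Filter.atTop, ρ n = f

/-- `B` models `φ`: it accepts exactly the words that satisfy `φ`. -/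
def BuchiAutomaton.Models {AP Q : Type*} (B : BuchiAutomaton AP Q) (φ : LTL AP) : Prop :=
  ∀ w, B.Accepts w ↔ φ.Sat w

/-! ### Weighted transition systems and the product graph -/

/-- The weighted transition system of a robot in a workspace with set of cells `S`. -/
structure TransitionSystem (AP S : Type*) where
  obst : Set S
  s₀ : S
  s₀_free : s₀ ∉ obst
  E : S → S → Prop
  E_free : ∀ s s', E s s' → s ∉ obst ∧ s' ∉ obst
  L : S → Set AP
  w : S → S → ℝ
  w_pos : ∀ s s', E s s' → 0 < w s s'

section

variable {AP S Q : Type*} (T : TransitionSystem AP S) (B : BuchiAutomaton AP Q)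

/-- The initial nodes of the product graph. -/
def ProdInit (v : S × Q) : Prop := v.1 = T.s₀ ∧ v.2 ∈ B.init

/-- The edges of the product graph: a move of the robot to a cell whose label allows the
corresponding move of the automaton. -/
def ProdEdge (v v' : S × Q) : Prop :=
  T.E v.1 v'.1 ∧ ∃ c, B.trans v.2 c v'.2 ∧ c.Sat (T.L v'.1)

/-! ### Reduced product graphs -/

/-- The distinct node condition for a pair of nodes `(s, q)`, `(s', q')`: they are distinct, `q` has
a self loop with a negative condition (so that the robot can wander while the automaton stays in
`q`), and a positive condition, which `s'` fulfils, leads from `q` to `q'`. -/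
def DistinctNode (v v' : S × Q) : Prop :=
  v ≠ v' ∧ (∃ c, c.Negative ∧ B.trans v.2 c v.2) ∧
    ∃ c, c.Positive ∧ B.trans v.2 c v'.2 ∧ c.Sat (T.L v'.1)

/-- A reduced graph of the product graph. Two nodes joined by an edge are adjacent in the product
graph or obey the distinct node condition; in the latter case their cells need not be adjacent.
The final nodes are those with a final automaton state. The root is the initial node of the graph,
or the current node of the robot once the graph has been updated. -/
structure ReducedGraph where
  V : Set (S × Q)
  root : S × Q
  root_mem : root ∈ V
  E : S × Q → S × Q → Prop
  E_mem : ∀ v v', E v v' → v ∈ V ∧ v' ∈ V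
  E_spec : ∀ v v', E v v' → ProdEdge T B v v' ∨ DistinctNode T B v v'

/-- The ways in which the robot may traverse an edge of a reduced graph from `v` to `v'`, as lists
of the nodes after `v`. If the nodes obey the distinct node condition, this is any path of cells
whose inner cells all fulfil the condition of a negative self loop at the automaton state of `v`;
the automaton stays in that state until the robot arrives. -/
inductive EdgePath (v v' : S × Q) : List (S × Q) → Prop
  | adjacent : ProdEdge T B v v' → EdgePath v v' [v']
  | distinct (c : Cond AP) (us : List S) :
      DistinctNode T B v v' → c.Negative → B.trans v.2 c v.2 →
      (∀ u ∈ us, c.Sat (T.L u)) → (v.1 :: (us ++ [v'.1])).IsChain T.E →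
      EdgePath v v' (us.map (fun u => (u, v.2)) ++ [v'])

/-! ### Time-dependent costs and shortest travel -/

/-- The state of the environment as known to the robot: `cost s s' t` is the time that the action
from `s` to `s'` takes when it is started at time `t`, waiting included, and `⊤` if the action
cannot be taken then. Dynamic obstacles can only increase the costs. -/
structure Env where
  cost : S → S → ℝ → WithTop ℝ
  w_le : ∀ s s' t, T.E s s' → (T.w s s' : WithTop ℝ) ≤ cost s s' t

/-- The static environment. -/
def Env.static : Env T where
  cost s s' _ := (T.w s s' : WithTop ℝ)
  w_le _ _ _ _ := le_rfl

variable {T} (D : Env T)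

/-- `p` lists, with their times of arrival, the nodes after `x` of a way from the timed node `x` to
the timed node `y` along one edge of a reduced graph. -/
def EdgeTravel (x : (S × Q) × ℝ) (p : List ((S × Q) × ℝ)) (y : (S × Q) × ℝ) : Prop :=
  EdgePath T B x.1 y.1 (p.map Prod.fst) ∧
  (x :: p).IsChain
    (fun a b => ((b.2 - a.2 : ℝ) : WithTop ℝ) = D.cost a.1.1 b.1.1 a.2) ∧
  p.getLast? = some y

/-- A quickest such way; its duration is the cost of the edge at time `x.2`. -/
def ShortestEdge (x : (S × Q) × ℝ) (p : List ((S × Q) × ℝ)) (y : (S × Q) × ℝ) : Prop :=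
  EdgeTravel B D x p y ∧ ∀ p' t', EdgeTravel B D x p' (y.1, t') → y.2 ≤ t'

variable {B}

/-- Timed walks, with at least one edge, in a reduced graph with these edge costs. -/
inductive Walk (G : ReducedGraph T B) :
    (S × Q) × ℝ → List ((S × Q) × ℝ) → (S × Q) × ℝ → Prop
  | edge {x y p} : G.E x.1 y.1 → ShortestEdge B D x p y → Walk G x p y
  | cons {x y z p p'} : G.E x.1 y.1 → ShortestEdge B D x p y → Walk G y p' z →
      Walk G x (p ++ p') z

/-- A quickest walk between two nodes of the reduced graph. -/
def ShortestWalk (G : ReducedGraph T B) (x : (S × Q) × ℝ) (p : List ((S × Q) × ℝ))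
    (y : (S × Q) × ℝ) : Prop :=
  Walk D G x p y ∧ ∀ p' t', Walk D G x p' (y.1, t') → y.2 ≤ t'

/-- The destination nodes: the final nodes of the reduced graph from which a suffix cycle exists in
the static workspace. -/
def Destination (G : ReducedGraph T B) (v : S × Q) : Prop :=
  v ∈ G.V ∧ v.2 ∈ B.final ∧ ∃ p t, Walk (Env.static T) G (v, 0) p (v, t)

/-! ### The static plan -/

/-- `u` is a shortest (possibly empty) way from the root of `G` to the node `d`, in the static
workspace. -/
def StaticPrefix (G : ReducedGraph T B) (u : List (S × Q)) (d : S × Q) : Prop :=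
  (d = G.root ∧ u = []) ∨
  (d ≠ G.root ∧
    ∃ p t, ShortestWalk (Env.static T) G (G.root, 0) p (d, t) ∧ u = p.map Prod.fst)

/-- The static plan `u · c^ω`: the prefix `u` leads from the root to a destination node, and the
suffix cycle `c` from there has minimal length among the suffix cycles from all the destination
nodes that can be reached from the root. -/
def StaticPlan (G : ReducedGraph T B) (u c : List (S × Q)) : Prop :=
  ∃ d, Destination G d ∧ StaticPrefix G u d ∧
    ∃ p t, Walk (Env.static T) G (d, 0) p (d, t) ∧ c = p.map Prod.fst ∧
      ∀ d' u' p' t', Destination G d' → StaticPrefix G u' d' →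
        Walk (Env.static T) G (d', 0) p' (d', t') → t ≤ t'

/-! ### The optimization problem and the plan within the horizon -/

/-- A decision of the robot: at the timed node `src` it takes the way `path` to `dst`. -/
structure Leg (S Q : Type*) where
  src : (S × Q) × ℝ
  path : List ((S × Q) × ℝ)
  dst : (S × Q) × ℝ

/-- The decisions that may be taken: quickest prefix paths to destination nodes and, if source and
destination node agree, quickest suffix cycles, completed at time `tmax` at the latest. -/
def IsDecision (G : ReducedGraph T B) (tmax : ℝ) (ℓ : Leg S Q) : Prop :=
  Destination G ℓ.dst.1 ∧ ShortestWalk D G ℓ.src ℓ.path ℓ.dst ∧ ℓ.dst.2 ≤ tmax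

/-- At `x = (lᵢ, tᵢ)`, `y = (lⱼ, tⱼ)` is one of the choices for the next decision. -/
def Choice (G : ReducedGraph T B) (tmax : ℝ) (x y : (S × Q) × ℝ) : Prop :=
  ∃ p, IsDecision D G tmax ⟨x, p, y⟩

/-- The constraints, as a predicate on the set `X` of all `(l, t)` whose Boolean variable `X_{l,t}`
is true. There are variables for the nodes of the decision tree that grows from `x₀` by repeated
choices, and `X_{l,t}` is to be true iff the robot is at `l` at time `t`, so a decision that was
taken leads there. -/
structure IsModel (R : (S × Q) × ℝ → (S × Q) × ℝ → Prop) (x₀ : (S × Q) × ℝ)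
    (X : Set ((S × Q) × ℝ)) : Prop where
  finite : X.Finite
  tree : ∀ x ∈ X, Relation.ReflTransGen R x₀ x
  reached : ∀ y ∈ X, y ≠ x₀ → ∃ x ∈ X, R x y
  start : x₀ ∈ X
  movement : ∀ x ∈ X, (∃ y, R x y) → ∃ y ∈ X, R x y
  exclusive : ∀ x, Relation.ReflTransGen R x₀ x → ∀ y z, R x y → R x z → y ≠ z → y ∈ X → z ∉ X
  integrity : ∀ x ∈ X, ∀ y ∈ X, x.2 = y.2 → x = y
  continuity : ∀ x ∈ X, ∀ y ∈ X, R x y → ¬ ∃ z ∈ X, x.2 < z.2 ∧ z.2 < y.2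

/-- The cycle completion variables that are true: the pairs `((l, tᵢ), (l, tⱼ))` such that the
robot is at `l` at time `tᵢ` and completes a cycle from there at time `tⱼ`. -/
def Cycles (R : (S × Q) × ℝ → (S × Q) × ℝ → Prop) (X : Set ((S × Q) × ℝ)) :
    Set (((S × Q) × ℝ) × ((S × Q) × ℝ)) :=
  {a | a.1 ∈ X ∧ a.2 ∈ X ∧ R a.1 a.2 ∧ a.1.1 = a.2.1}

/-- The cycle that is completed last. -/
def IsLastCycle (R : (S × Q) × ℝ → (S × Q) × ℝ → Prop) (X : Set ((S × Q) × ℝ))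
    (a : ((S × Q) × ℝ) × ((S × Q) × ℝ)) : Prop :=
  a ∈ Cycles R X ∧ ∀ b ∈ Cycles R X, b.2.2 ≤ a.2.2

/-- `X'` is preferred to `X` by the lexicographic objective: more cycles, then a shorter last cycle,
then an earlier completion of the last cycle. -/
def Preferred (R : (S × Q) × ℝ → (S × Q) × ℝ → Prop) (X' X : Set ((S × Q) × ℝ)) : Prop :=
  (Cycles R X).ncard < (Cycles R X').ncard ∨
  ((Cycles R X).ncard = (Cycles R X').ncard ∧
    ∃ a b, IsLastCycle R X a ∧ IsLastCycle R X' b ∧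
      (b.2.2 - b.1.2 < a.2.2 - a.1.2 ∨
        (b.2.2 - b.1.2 = a.2.2 - a.1.2 ∧ b.2.2 < a.2.2)))

/-- The optimal solutions of the constraints. -/
def IsOptimalModel (R : (S × Q) × ℝ → (S × Q) × ℝ → Prop) (x₀ : (S × Q) × ℝ)
    (X : Set ((S × Q) × ℝ)) : Prop :=
  IsModel R x₀ X ∧ ∀ X', IsModel R x₀ X' → ¬ Preferred R X' X

/-- The legs are decisions that follow one another, starting from `x`. -/
def IsDecisionSeq (G : ReducedGraph T B) (tmax : ℝ) : (S × Q) × ℝ → List (Leg S Q) → Prop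
  | _, [] => True
  | x, ℓ :: ls => ℓ.src = x ∧ IsDecision D G tmax ℓ ∧ IsDecisionSeq G tmax ℓ.dst ls

/-- `legs` is a plan from the root of `G` at time `t` within the horizon `H`: the sequence of timed
decisions read off an optimal model in which at least one cycle is completed. -/
def PlanInH (G : ReducedGraph T B) (t H : ℝ) (legs : List (Leg S Q)) : Prop :=
  ∃ X, IsOptimalModel (Choice D G (t + H)) (G.root, t) X ∧
    (Cycles (Choice D G (t + H)) X).Nonempty ∧
    IsDecisionSeq D G (t + H) (G.root, t) legs ∧
    ∀ x, x ∈ X ↔ x = (G.root, t) ∨ x ∈ legs.map Leg.dst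

/-! ### The algorithm -/

/-- What is left of a plan: a list of timed nodes, or the remainder `u · c^ω` of the static plan. -/
inductive Plan (S Q : Type*) where
  | timed : List ((S × Q) × ℝ) → Plan S Q
  | lasso : List (S × Q) → List (S × Q) → Plan S Q

/-- The nodes that a sequence of decisions visits. -/
def visited (legs : List (Leg S Q)) : List (S × Q) :=
  legs.flatMap (fun ℓ => ℓ.path.map Prod.fst)

/-- The configurations of the algorithm. Both kinds hold the trajectory `h` up to now (the list of
the nodes visited, the current one last) and the current time. -/
inductive Config (T : TransitionSystem AP S) (B : BuchiAutomaton AP Q) where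
  /-- the robot executes a plan -/
  | executing (h : List (S × Q)) (t : ℝ) (R : Plan S Q) : Config T B
  /-- the algorithm computes a new plan, for an observed environment and an updated graph -/
  | planning (h : List (S × Q)) (t : ℝ) (D : Env T) (G : ReducedGraph T B) : Config T B

/-- The configurations that the algorithm can reach with computation time `ν` and horizon `H`. -/
inductive Reachable (T : TransitionSystem AP S) (B : BuchiAutomaton AP Q) (ν H : ℝ) :
    Config T B → Prop
  /-- begin with a static plan -/
  | start (G : ReducedGraph T B) (u c : List (S × Q)) :
      ProdInit T B G.root → StaticPlan G u c →
      Reachable T B ν H (.executing [G.root] 0 (.lasso u c))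
  /-- move the robot to the next node of the prefix of the static plan -/
  | moveprefix (h : List (S × Q)) (t : ℝ) (pos v : S × Q) (u c : List (S × Q)) :
      Reachable T B ν H (.executing h t (.lasso (v :: u) c)) → h.getLast? = some pos →
      Reachable T B ν H (.executing (h ++ [v]) (t + T.w pos.1 v.1) (.lasso u c))
  /-- enter the suffix cycle of the static plan once more -/
  | movecycle (h : List (S × Q)) (t : ℝ) (pos v : S × Q) (c : List (S × Q)) :
      Reachable T B ν H (.executing h t (.lasso [] (v :: c))) → h.getLast? = some pos →
      Reachable T B ν H (.executing (h ++ [v]) (t + T.w pos.1 v.1) (.lasso c (v :: c)))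
  /-- move the robot to the next node of a plan with a finite horizon -/
  | move (h : List (S × Q)) (t t' : ℝ) (v : S × Q) (r : List ((S × Q) × ℝ)) :
      Reachable T B ν H (.executing h t (.timed ((v, t') :: r))) →
      Reachable T B ν H (.executing (h ++ [v]) t' (.timed r))
  /-- a change is observed, or the plan is finished: update the graph and plan again -/
  | observe (h : List (S × Q)) (t : ℝ) (R : Plan S Q) (D : Env T) (G : ReducedGraph T B) :
      Reachable T B ν H (.executing h t R) → h.getLast? = some G.root →
      Reachable T B ν H (.planning h t D G)
  /-- no plan was found: try again later -/
  | fail (h : List (S × Q)) (t : ℝ) (D : Env T) (G : ReducedGraph T B) :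
      Reachable T B ν H (.planning h t D G) → (¬ ∃ legs, PlanInH D G (t + ν) H legs) →
      Reachable T B ν H (.planning h (t + ν) D G)
  /-- a plan was found: execute it -/
  | plan (h : List (S × Q)) (t : ℝ) (D : Env T) (G : ReducedGraph T B) (legs : List (Leg S Q)) :
      Reachable T B ν H (.planning h t D G) → PlanInH D G (t + ν) H legs →
      Reachable T B ν H (.executing h (t + ν) (.timed (legs.flatMap Leg.path)))

/-! ### Obeying the specification -/

/-- The infinite sequence `σ` extends the list `l`. -/
def Extends {α : Type*} (σ : ℕ → α) (l : List α) : Prop :=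
  ∀ i x, l[i]? = some x → σ i = x

/-- `σ` is the sequence `u · v^ω`. -/
def IsLasso {α : Type*} (σ : ℕ → α) (u v : List α) : Prop :=
  v ≠ [] ∧ Extends σ u ∧ ∀ m i x, v[i]? = some x → σ (u.length + m * v.length + i) = x

/-- `σ` performs the trajectory and the remaining plan of a configuration. -/
def Config.PerformedBy (σ : ℕ → S × Q) : Config T B → Prop
  | .executing h _ (.timed r) => Extends σ (h ++ r.map Prod.fst)
  | .executing h _ (.lasso u c) => IsLasso σ (h ++ u) c
  | .planning h _ _ _ => Extends σ h

/-- The cells of `σ` form an infinite trajectory of the robot from its initial cell that satisfies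
`φ`. As in the product graph, the automaton reads a cell when the robot enters it, so the word of
the trajectory `s₀ s₁ s₂ …` is `L(s₁) L(s₂) …`. If the automaton can also enter the state of `σ 0`
from an initial state by reading `L(s₀)`, then the word `L(s₀) L(s₁) …` satisfies `φ` as well. -/
def Obeys (T : TransitionSystem AP S) (B : BuchiAutomaton AP Q) (φ : LTL AP) (σ : ℕ → S × Q) :
    Prop :=
  (σ 0).1 = T.s₀ ∧ (∀ n, T.E (σ n).1 (σ (n + 1)).1) ∧
  φ.Sat (fun n => T.L (σ (n + 1)).1) ∧
  ((∃ q ∈ B.init, B.Step q (T.L T.s₀) (σ 0).2) → φ.Sat (fun n => T.L (σ n).1))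

end

end DTStar

namespace DTStar

/-! ### Lassos -/

/-! The proof carries one invariant through the reachable configurations: the trajectory with the
remaining plan is performed by an `AcceptingRun`, an infinite product path from an initial node on
which a final state recurs. Its automaton component is an accepting Büchi run, so `φ` holds
(`AcceptingRun.obeys`).

Executing a plan keeps the run: a move only shifts a node from plan to history, and entering the
suffix cycle unrolls the lasso. Observing a change forgets the rest of the plan. After replanning, a
new run is built. Every edge of a reduced graph expands to a product path (`EdgePath.prodPath`), so
history and decisions form one product path. It ends at a destination, whose final state has a
static suffix cycle; repeating that cycle forever gives an accepting lasso
(`AcceptingRun.exists_isLasso`). The second claim repeats this construction, with the planned cycle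
in place of the static one. -/

theorem Extends.append_left {α : Type*} {σ : ℕ → α} {l l' : List α} (h : Extends σ (l ++ l')) :
    Extends σ l := by
  intro i x hx
  obtain ⟨hi, -⟩ := List.getElem?_eq_some_iff.1 hx
  exact h i x (by rw [List.getElem?_append_left hi, hx])

theorem Extends.isChain {α : Type*} {r : α → α → Prop} {σ : ℕ → α} {l : List α}
    (h : Extends σ l) (hσ : ∀ n, r (σ n) (σ (n + 1))) : l.IsChain r := by
  rw [List.isChain_iff_getElem]
  intro i hi
  rw [← h i _ (List.getElem?_eq_getElem (by omega)), ← h (i + 1) _ (List.getElem?_eq_getElem hi)]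
  exact hσ i

theorem exists_isLasso {α : Type*} (u v : List α) (hv : v ≠ []) : ∃ σ : ℕ → α, IsLasso σ u v := by
  have hpos : 0 < v.length := List.length_pos_iff.2 hv
  -- The default of `getD` is the periodic part; it is read only for `n ≥ u.length`, so the
  -- truncated subtraction is exact there.
  refine ⟨fun n => u.getD n (v[(n - u.length) % v.length]'(Nat.mod_lt _ hpos)), hv, ?_, ?_⟩
  · intro i x hx
    simp [List.getD, hx]
  · intro m i x hx
    obtain ⟨hi, rfl⟩ := List.getElem?_eq_some_iff.1 hx
    have hmod : (u.length + m * v.length + i - u.length) % v.length = i := by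
      rw [show u.length + m * v.length + i - u.length = i + m * v.length by omega,
        Nat.add_mul_mod_self_right, Nat.mod_eq_of_lt hi]
    have hnone : u[u.length + m * v.length + i]? = none := List.getElem?_eq_none (by omega)
    simp only [List.getD, hnone, Option.getD_none, hmod]

/-- Unrolling the cycle of a lasso once. -/
theorem IsLasso.unroll {α : Type*} {σ : ℕ → α} {u v : List α} (h : IsLasso σ u v) :
    IsLasso σ (u ++ v) v := by
  obtain ⟨hv, hu, hc⟩ := h
  refine ⟨hv, ?_, ?_⟩
  · intro i x hx
    rcases lt_or_ge i u.length with hi | hi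
    · exact hu i x (by rwa [List.getElem?_append_left hi] at hx)
    · rw [List.getElem?_append_right hi] at hx
      have := hc 0 (i - u.length) x hx
      rwa [Nat.zero_mul, Nat.add_zero, Nat.add_sub_cancel' hi] at this
  · intro m i x hx
    have := hc (m + 1) i x hx
    rwa [Nat.succ_mul, Nat.add_comm (m * v.length), ← Nat.add_assoc, ← List.length_append] at this

/-- The last entry of the prefix of a lasso recurs, if it is the last entry of the cycle. -/
theorem IsLasso.recurs {α : Type*} {σ : ℕ → α} {u v : List α} {x : α} (h : IsLasso σ u v)
    (hu : u.getLast? = some x) (hv : v.getLast? = some x) (m : ℕ) :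
    σ (u.length - 1 + m * v.length) = x := by
  have hupos : 0 < u.length := List.length_pos_iff.2 (by rintro rfl; simp at hu)
  have hvpos : 0 < v.length := List.length_pos_iff.2 h.1
  rw [List.getLast?_eq_getElem?] at hu hv
  -- For `0` this is the end of `u`; for `m + 1` it is the end of copy `m` of the cycle.
  cases m with
  | zero => simpa using h.2.1 _ _ hu
  | succ m =>
    have := h.2.2 m _ _ hv
    rwa [show u.length + m * v.length + (v.length - 1) = u.length - 1 + (m + 1) * v.length by
      rw [Nat.succ_mul]; omega] at this

/-- Since `u` and `v` both end in `x`, each copy of `v` is preceded by `x`. Hence the chain `x :: v`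
covers the steps inside a copy as well as the step into it, and its index is off by one from that of
`v`. -/
theorem IsLasso.step {α : Type*} {r : α → α → Prop} {σ : ℕ → α} {u v : List α} {x : α}
    (h : IsLasso σ u v) (hu : u.getLast? = some x) (hv : v.getLast? = some x)
    (hru : u.IsChain r) (hrv : (x :: v).IsChain r) (n : ℕ) : r (σ n) (σ (n + 1)) := by
  have hupos : 0 < u.length := List.length_pos_iff.2 (by rintro rfl; simp at hu)
  have hvpos : 0 < v.length := List.length_pos_iff.2 h.1
  rcases lt_or_ge (n + 1) u.length with hn | hn
  · rw [h.2.1 n _ (List.getElem?_eq_getElem (by omega)),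
      h.2.1 (n + 1) _ (List.getElem?_eq_getElem hn)]
    exact List.isChain_iff_getElem.1 hru n hn
  · have hdiv := Nat.div_add_mod' (n + 1 - u.length) v.length
    have hi := Nat.mod_lt (n + 1 - u.length) hvpos
    generalize (n + 1 - u.length) / v.length = m at hdiv
    generalize (n + 1 - u.length) % v.length = i at hdiv hi
    have hnext : σ (n + 1) = v[i] := by
      rw [show n + 1 = u.length + m * v.length + i by omega]
      exact h.2.2 m i _ (List.getElem?_eq_getElem hi)
    have hcur : σ n = (x :: v)[i]'(by simp; omega) := by
      cases i with
      | zero =>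
        rw [show n = u.length - 1 + m * v.length by omega]
        exact h.recurs hu hv m
      | succ i =>
        rw [show n = u.length + m * v.length + i by omega]
        exact h.2.2 m i _ (by simp)
    rw [hnext, hcur]
    exact List.isChain_iff_getElem.1 hrv i (by simp; omega)

section

variable {AP S Q : Type*} {T : TransitionSystem AP S} {B : BuchiAutomaton AP Q}

/-! ### Accepting runs of the product graph -/

/-- `σ` is an infinite path of the product graph from an initial node on which some final state of
the automaton recurs. -/
structure AcceptingRun (T : TransitionSystem AP S) (B : BuchiAutomaton AP Q) (σ : ℕ → S × Q) :
    Prop where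
  init : ProdInit T B (σ 0)
  edge : ∀ n, ProdEdge T B (σ n) (σ (n + 1))
  recurs : ∃ f ∈ B.final, ∃ᶠ n in Filter.atTop, (σ n).2 = f

/-- The product reads a cell on entering it, so the automaton component is a run over the word that
omits the first cell. -/
theorem AcceptingRun.obeys {φ : LTL AP} (hB : B.Models φ) {σ : ℕ → S × Q}
    (h : AcceptingRun T B σ) : Obeys T B φ σ := by
  refine ⟨h.init.1, fun n => (h.edge n).1, ?_, ?_⟩
  · exact (hB _).1 ⟨fun n => (σ n).2, h.init.2, fun n => (h.edge n).2, h.recurs⟩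
  · rintro ⟨q, hq, hstep⟩
    -- For the full word the run is delayed by one and starts in `q`, which reads the label of the
    -- initial cell.
    refine (hB _).1 ⟨fun n => Nat.casesOn n q fun k => (σ k).2, hq, ?_, ?_⟩
    · rintro (_ | n)
      · change B.Step q (T.L (σ 0).1) (σ 0).2
        rwa [h.init.1]
      · exact (h.edge n).2
    · obtain ⟨f, hf, hfreq⟩ := h.recurs
      refine ⟨f, hf, Filter.frequently_atTop.2 fun a => ?_⟩
      obtain ⟨b, hab, hb⟩ := Filter.frequently_atTop.1 hfreq a
      exact ⟨b + 1, by omega, hb⟩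

/-- A path of the product graph from an initial node to a final one, followed by a cycle there, is
an accepting run. -/
theorem IsLasso.acceptingRun {σ : ℕ → S × Q} {u v : List (S × Q)} {v₀ x : S × Q}
    (h : IsLasso σ u v) (hinit : ProdInit T B v₀) (hhead : u.head? = some v₀)
    (hu : u.getLast? = some x) (hv : v.getLast? = some x) (hx : x.2 ∈ B.final)
    (hchain : u.IsChain (ProdEdge T B)) (hcycle : (x :: v).IsChain (ProdEdge T B)) :
    AcceptingRun T B σ where
  init := by
    rw [List.head?_eq_getElem?] at hhead
    rwa [h.2.1 0 v₀ hhead]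
  edge := h.step hu hv hchain hcycle
  recurs := by
    -- The `a`-th recurrence of `x` lies at or beyond position `a` because the cycle is nonempty.
    refine ⟨x.2, hx, Filter.frequently_atTop.2 fun a => ⟨u.length - 1 + a * v.length, ?_, ?_⟩⟩
    · exact (Nat.le_mul_of_pos_right a (List.length_pos_iff.2 h.1)).trans (Nat.le_add_left _ _)
    · rw [h.recurs hu hv a]

/-! ### Paths of the product graph -/

/-- `p` lists the nodes after `v` of a nonempty path of the product graph from `v` to `v'`. -/
def ProdPath (T : TransitionSystem AP S) (B : BuchiAutomaton AP Q) (v : S × Q)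
    (p : List (S × Q)) (v' : S × Q) : Prop :=
  (v :: p).IsChain (ProdEdge T B) ∧ p.getLast? = some v'

theorem isChain_append_path {α : Type*} {r : α → α → Prop} {l p : List α} {x : α}
    (hl : l.IsChain r) (hx : l.getLast? = some x) (hp : (x :: p).IsChain r) :
    (l ++ p).IsChain r := by
  refine List.isChain_append.2 ⟨hl, hp.tail, ?_⟩
  intro a ha b hb
  rw [hx] at ha
  obtain rfl := Option.mem_some.1 ha
  cases p with
  | nil => simp at hb
  | cons c p =>
    obtain rfl : c = b := by simpa using hb
    exact (List.isChain_cons_cons.1 hp).1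

theorem getLast?_append_path {α : Type*} {l p : List α} {x : α} (hp : p.getLast? = some x) :
    (l ++ p).getLast? = some x := by
  rw [List.getLast?_append, hp, Option.some_or]

theorem ProdPath.trans {x y z : S × Q} {p p' : List (S × Q)} (h : ProdPath T B x p y)
    (h' : ProdPath T B y p' z) : ProdPath T B x (p ++ p') z :=
  ⟨isChain_append_path (l := x :: p) h.1 (getLast?_append_path (l := [x]) h.2) h'.1,
    getLast?_append_path h'.2⟩

/-- While the robot wanders, the automaton takes the self loop at each inner cell; on arrival it
takes the positive transition. Only entered cells are read, so the starting cell need not satisfy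
the loop condition. -/
theorem EdgePath.prodPath {v v' : S × Q} {p : List (S × Q)} (h : EdgePath T B v v' p) :
    ProdPath T B v p v' := by
  cases h with
  | adjacent h => exact ⟨by simpa using h, rfl⟩
  | distinct c us hdist _ htrans hsat hchain =>
    refine ⟨?_, by simp⟩
    obtain ⟨-, -, c', -, htrans', hsat'⟩ := hdist
    -- The starting cell is generalized for the induction, while the automaton state stays fixed at
    -- `v.2`.
    have key : ∀ (us : List S) (s : S), (∀ u ∈ us, c.Sat (T.L u)) →
        (s :: (us ++ [v'.1])).IsChain T.E →
        ((s, v.2) :: (us.map (fun u => (u, v.2)) ++ [v'])).IsChain (ProdEdge T B) := by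
      intro us
      induction us with
      | nil =>
        intro s _ hs
        simp only [List.nil_append, List.isChain_cons_cons] at hs
        exact List.isChain_pair.2 ⟨hs.1, c', htrans', hsat'⟩
      | cons u us ih =>
        intro s hus hs
        simp only [List.cons_append, List.isChain_cons_cons] at hs
        simp only [List.map_cons, List.cons_append, List.isChain_cons_cons]
        exact ⟨⟨hs.1, c, htrans, hus u (by simp)⟩,
          ih u (fun w hw => hus w (by simp [hw])) hs.2⟩
    exact key us v.1 hsat hchain

theorem Walk.prodPath {D : Env T} {G : ReducedGraph T B} {x y : (S × Q) × ℝ}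
    {p : List ((S × Q) × ℝ)} (h : Walk D G x p y) : ProdPath T B x.1 (p.map Prod.fst) y.1 := by
  induction h with
  | edge _ h => exact h.1.1.prodPath
  | cons _ h _ ih =>
    rw [List.map_append]
    exact h.1.1.prodPath.trans ih

theorem Walk.getLast? {D : Env T} {G : ReducedGraph T B} {x y : (S × Q) × ℝ}
    {p : List ((S × Q) × ℝ)} (h : Walk D G x p y) : p.getLast? = some y := by
  induction h with
  | edge _ h => exact h.1.2.2
  | cons _ _ _ ih => exact getLast?_append_path ih

theorem StaticPrefix.prodPath {G : ReducedGraph T B} {u : List (S × Q)} {d : S × Q}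
    (h : StaticPrefix G u d) :
    (G.root :: u).IsChain (ProdEdge T B) ∧ (G.root :: u).getLast? = some d := by
  rcases h with ⟨rfl, rfl⟩ | ⟨-, p, t, h, rfl⟩
  · simp
  · exact ⟨h.1.prodPath.1, getLast?_append_path (l := [G.root]) h.1.prodPath.2⟩

/-! ### Sequences of decisions -/

/-- The default `x` covers the case of a first decision; the same `getD` expression describes the
endpoint in `isChain_visited`, so the two can be matched. -/
theorem IsDecisionSeq.isDecision {D : Env T} {G : ReducedGraph T B} {tmax : ℝ}
    {ℓ : Leg S Q} {pre post : List (Leg S Q)} :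
    ∀ {x : (S × Q) × ℝ}, IsDecisionSeq D G tmax x (pre ++ ℓ :: post) →
      IsDecision D G tmax ℓ ∧ IsDecisionSeq D G tmax x pre ∧
        ℓ.src = (pre.getLast?.map Leg.dst).getD x := by
  induction pre with
  | nil => exact fun h => ⟨h.2.1, trivial, h.1⟩
  | cons ℓ' pre ih =>
    intro x h
    obtain ⟨hdec, hseq, hsrc⟩ := ih h.2.2
    refine ⟨hdec, ⟨h.1, h.2.1, hseq⟩, ?_⟩
    rw [hsrc, List.getLast?_cons, Option.map_some, Option.getD_some, Option.getD_map]

/-- The decisions continue a path of the product graph that ends where they start. -/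
theorem IsDecisionSeq.isChain_visited {D : Env T} {G : ReducedGraph T B} {tmax : ℝ}
    {legs : List (Leg S Q)} :
    ∀ {x : (S × Q) × ℝ} {h : List (S × Q)}, IsDecisionSeq D G tmax x legs →
      h.IsChain (ProdEdge T B) → h.getLast? = some x.1 →
      (h ++ visited legs).IsChain (ProdEdge T B) ∧
        (h ++ visited legs).getLast? = some ((legs.getLast?.map Leg.dst).getD x).1 := by
  induction legs with
  | nil => exact fun _ hh hx => ⟨by simpa [visited] using hh, by simpa [visited] using hx⟩
  | cons ℓ legs ih =>
    intro x h hseq hh hx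
    obtain ⟨rfl, hdec, hseq⟩ := hseq
    have hp := hdec.2.1.1.prodPath
    have := ih hseq (isChain_append_path hh hx hp.1) (getLast?_append_path hp.2)
    rw [List.append_assoc] at this
    rw [List.getLast?_cons, Option.map_some, Option.getD_some, ← Option.getD_map Leg.dst]
    exact this

/-! ### The invariant of the algorithm -/

/-- A path of an accepting run, prolonged by a path to a final node and by a cycle there, gives an
accepting run. -/
theorem AcceptingRun.exists_isLasso {σ : ℕ → S × Q} {h u v : List (S × Q)} {x : S × Q}
    (hσ : AcceptingRun T B σ) (hh : Extends σ h) (hne : h ≠ [])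
    (hchain : (h ++ u).IsChain (ProdEdge T B)) (hlast : (h ++ u).getLast? = some x)
    (hx : x.2 ∈ B.final) (hv : ProdPath T B x v x) :
    ∃ σ' : ℕ → S × Q, IsLasso σ' (h ++ u) v ∧ AcceptingRun T B σ' := by
  obtain ⟨σ', hσ'⟩ := DTStar.exists_isLasso (h ++ u) v (by rintro rfl; simpa using hv.2)
  refine ⟨σ', hσ', hσ'.acceptingRun hσ.init ?_ hlast hv.2 hx hchain hv.1⟩
  cases h with
  | nil => exact absurd rfl hne
  | cons a h => simpa using (hh 0 a (by simp)).symm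

/-- The robot is at the root of the graph for which it computes a new plan. -/
def Config.AtRoot : Config T B → Prop
  | .executing _ _ _ => True
  | .planning h _ _ G => h.getLast? = some G.root

theorem Reachable.atRoot {ν H : ℝ} {C : Config T B} (hC : Reachable T B ν H C) : C.AtRoot := by
  induction hC with
  | observe _ _ _ _ _ _ hroot => exact hroot
  | fail _ _ _ _ _ _ ih => exact ih
  | _ => trivial

/-- An accepting run is kept rather than mere satisfaction of `φ`: replanning needs the history to
be a product path from an initial node, automaton states included. -/
theorem Reachable.exists_acceptingRun {ν H : ℝ} {C : Config T B} (hC : Reachable T B ν H C) :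
    ∃ σ : ℕ → S × Q, C.PerformedBy σ ∧ AcceptingRun T B σ := by
  induction hC with
  | start G u c hinit hplan =>
    obtain ⟨d, hdest, hprefix, p, t, hp, rfl, -⟩ := hplan
    obtain ⟨hchain, hlast⟩ := hprefix.prodPath
    have hcycle : ProdPath T B d (p.map Prod.fst) d := hp.prodPath
    obtain ⟨σ, hσ⟩ := exists_isLasso (G.root :: u) (p.map Prod.fst)
      (fun h => by simpa [h] using hcycle.2)
    exact ⟨σ, hσ, hσ.acceptingRun hinit rfl hlast hcycle.2 hdest.2.1 hchain hcycle.1⟩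
  | moveprefix h t pos v u c _ _ ih =>
    simpa [Config.PerformedBy] using ih
  | movecycle h t pos v c _ _ ih =>
    obtain ⟨σ, hσ, hacc⟩ := ih
    have hσ : IsLasso σ (h ++ []) (v :: c) := hσ
    rw [List.append_nil] at hσ
    exact ⟨σ, by simpa [Config.PerformedBy] using hσ.unroll, hacc⟩
  | move h t t' v r _ ih =>
    simpa [Config.PerformedBy] using ih
  | observe h t R D G _ _ ih =>
    obtain ⟨σ, hσ, hacc⟩ := ih
    refine ⟨σ, ?_, hacc⟩
    cases R with
    | timed r => exact Extends.append_left (l' := r.map Prod.fst) hσ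
    | lasso u c => exact Extends.append_left (l' := u) hσ.2.1
  | fail h t D G _ _ ih => exact ih
  | plan h t D G legs hreach hplan ih =>
    obtain ⟨σ, hσ, hacc⟩ := ih
    obtain ⟨X, -, -, hseq, -⟩ := hplan
    have hσ : Extends σ h := hσ
    have hroot : h.getLast? = some G.root := hreach.atRoot
    have hvis : (legs.flatMap Leg.path).map Prod.fst = visited legs := by
      simp [visited, List.map_flatMap]
    simp only [Config.PerformedBy, hvis]
    -- Without decisions the old run still serves; otherwise the last decision supplies the
    -- destination at which to close the lasso.
    rcases List.eq_nil_or_concat legs with rfl | ⟨pre, ℓ, rfl⟩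
    · exact ⟨σ, by simpa [visited] using hσ, hacc⟩
    · rw [List.concat_eq_append] at hseq ⊢
      obtain ⟨hchain, hlast⟩ := hseq.isChain_visited (hσ.isChain hacc.edge) hroot
      rw [List.getLast?_concat, Option.map_some, Option.getD_some] at hlast
      -- This cycle exists in the static environment, not in `D`, which is harmless because product
      -- paths do not involve costs.
      obtain ⟨-, hfinal, p, t', hp⟩ := hseq.isDecision.1.1
      obtain ⟨σ', hσ', hacc'⟩ := hacc.exists_isLasso hσ (fun h0 => by simp [h0] at hroot) hchain hlast
        hfinal hp.prodPath
      exact ⟨σ', hσ'.2.1, hacc'⟩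

end

end DTStar

theorem mainTheorem1 {AP S Q : Type*} [Finite Q]
    (T : DTStar.TransitionSystem AP S) (φ : DTStar.LTL AP)
    (B : DTStar.BuchiAutomaton AP Q) (hB : B.Models φ) (ν H : ℝ) :
    -- at any time, some infinite trajectory that satisfies `φ` performs the trajectory
    -- up to now and the remaining plan
    (∀ C : DTStar.Config T B, DTStar.Reachable T B ν H C →
      ∃ σ : ℕ → S × Q, C.PerformedBy σ ∧ DTStar.Obeys T B φ σ) ∧
    -- in every plan that is generated, every decision is a path in the product graph, and
    -- every suffix cycle, when repeated forever, gives a trajectory that satisfies `φ`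
    (∀ (h : List (S × Q)) (t : ℝ) (D : DTStar.Env T) (G : DTStar.ReducedGraph T B)
      (legs : List (DTStar.Leg S Q)),
      DTStar.Reachable T B ν H (.planning h t D G) → DTStar.PlanInH D G (t + ν) H legs →
      ∀ (pre post : List (DTStar.Leg S Q)) (ℓ : DTStar.Leg S Q), legs = pre ++ ℓ :: post →
        (ℓ.src.1 :: ℓ.path.map Prod.fst).IsChain (DTStar.ProdEdge T B) ∧
        ℓ.path.getLast? = some ℓ.dst ∧
        (ℓ.src.1 = ℓ.dst.1 → ∃ σ : ℕ → S × Q,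
          DTStar.IsLasso σ (h ++ DTStar.visited pre) (ℓ.path.map Prod.fst) ∧
          DTStar.Obeys T B φ σ)) := by
  refine ⟨fun C hC => ?_, fun h t D G legs hreach hplan pre post ℓ hlegs => ?_⟩
  · obtain ⟨σ, hσ, hacc⟩ := hC.exists_acceptingRun
    exact ⟨σ, hσ, hacc.obeys hB⟩
  · obtain ⟨X, -, -, hseq, -⟩ := hplan
    subst hlegs
    obtain ⟨hdec, hpre, hsrc⟩ := hseq.isDecision
    have hpath := hdec.2.1.1.prodPath
    refine ⟨hpath.1, hdec.2.1.1.getLast?, fun hcycle => ?_⟩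
    obtain ⟨σ, hσ, hacc⟩ := hreach.exists_acceptingRun
    have hσ : DTStar.Extends σ h := hσ
    have hroot : h.getLast? = some G.root := hreach.atRoot
    obtain ⟨hchain, hlast⟩ := hpre.isChain_visited (hσ.isChain hacc.edge) hroot
    -- The earlier decisions end where `ℓ` starts, which is also its destination, so its own path is
    -- the cycle to repeat.
    rw [← hsrc, hcycle] at hlast
    rw [hcycle] at hpath
    obtain ⟨σ', hσ', hacc'⟩ := hacc.exists_isLasso hσ (fun h0 => by simp [h0] at hroot) hchain hlast
      hdec.1.2.1 hpath
    exact ⟨σ', hσ', hacc'.obeys hB⟩
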